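/- Let $d\ge 1$, $X=\mathbb T^d$ with angle coordinates $x=(\theta^1,\dots,\theta^d)$ modulo $2\pi$, $\phi_j(x)=\prod_{i}e^{\mathrm i j_i\theta^i}$ for $j\in\mathbb Z^d$, and fix $p\in(0,1)$. For frequencies $\alpha_1,\dots,\alpha_d>0$ that are linearly independent over $\mathbb Q$, let $\Phi^t(x)=(\theta^1+\alpha_1t,\dots,\theta^d+\alpha_dt) \bmod 2\pi$ and $U^tf=f\circ\Phi^t$. Let $n=dq$ with $q\ge1$ and $J_n=\{-2^{q-1},\dots,-1,1,\dots,2^{q-1}\}^d$. For $\tau>0$ put $|j|_p=\sum_i|j_i|^p$ and $\psi_j=e^{-\tau|j|_p/2}\phi_j$, and let $\mathcal H_{\tau,n}$ be the span of $\{\psi_j: j\in J_n\}$ with the inner product in which the $\psi_j$ are orthonormal; it is a reproducing kernel Hilbert space with kernel $k_{\tau,n}(x,x')=\sum_{j\in J_n}\overline{\psi_j(x)}\,\psi_j(x')$. Let $\kappa_{\tau,n}=k_{\tau,n}(x,x)=\sum_{j\in J_n}e^{-\tau|j|_p}$, $\xi_{x,\tau,n}=k_{\tau,n}(x,\cdot)/\sqrt{\kappa_{\tau,n}}$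 and $\rho_{x,\tau,n}=\langle\xi_{x,\tau,n},\cdot\rangle\,\xi_{x,\tau,n}$. Let $\mathbb B_n=(\mathbb C^2)^{\otimes n}$ with computational basis $|\boldsymbol b\rangle$, $\boldsymbol b=(\boldsymbol b^{(1)},\dots,\boldsymbol b^{(d)})$, each $\boldsymbol b^{(i)}$ being a binary string of length $q$ that is identified with an integer in $\{0,\dots,2^q-1\}$ (most significant bit first). Let $W_n:\mathcal H_{\tau,n}\to\mathbb B_n$ be the unitary map with $W_n\psi_j=|o(j_1),\dots,o(j_d)\rangle$, where $o$ is the increasing enumeration of $\{-2^{q-1},\dots,-1,1,\dots,2^{q-1}\}$ by $0,\dots,2^q-1$. Let $\mathfrak F_q|m\rangle=2^{-q/2}\sum_{k=0}^{2^q-1}e^{-2\pi \mathrm i km/2^q}|k\rangle$ be the $q$-qubit quantum Fourier transform, $\mathfrak F_{n,d}=\mathfrak F_q^{\otimes d}$, and let $$\tilde\rho_{x,\tau,n}=\mathfrak F_{n,d}^*\,W_n\,\rho_{x,\tau,n}\,W_n^*\,\mathfrak F_{n,d}.$$ Write $\langle A\rangle_\rho=\operatorname{tr}(\rho A)$. Let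 $f=\sum_{m\in\mathbb Z^d}\hat f_m\phi_m$ belong to the Wiener algebra of $X$, i.e. $f$ has Fourier coefficients $\hat f_m$ with $\sum_m|\hat f_m|<\infty$ and is the sum of its Fourier series. For $M\in\mathbb N$ let $f^{(M)}=\sum_{|m|\le M}\hat f_m\phi_m$ with $|m|=\max_i|m_i|$, and let $D^{(M)}_n$, $E^{(M)}_n$ be the operators on $\mathbb B_n$ with $$D^{(M)}_n|\boldsymbol b\rangle=f^{(M)}(x_{\boldsymbol b})|\boldsymbol b\rangle,\qquad E^{(M)}_n|\boldsymbol b\rangle=\operatorname{Re}f^{(M)}(x_{\boldsymbol b})|\boldsymbol b\rangle,\qquad x_{\boldsymbol b}=2\pi 2^{-q}(\boldsymbol b^{(1)},\dots,\boldsymbol b^{(d)}).$$ Then there is a sequence $(\tau_M)_{M\in\mathbb N}$ of positive numbers, strictly decreasing to $0$, such that for all frequencies $\alpha$ as above the functions $$\tilde f^{(t)}_{M,n}(x)=\big\langle D^{(M)}_n\big\rangle_{\tilde\rho_{\Phi^t(x),\tau_M,n}}$$ satisfy $$\lim_{M\to\infty}\ \lim_{n\to\infty}\tilde f^{(t)}_{M,n}(x)=U^tf(x)=f(\Phi^t(x)),$$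 where $n$ runs through the multiples of $d$, the inner limit exists for every $M$, and both limits are uniform in $x\in X$ and in $t$ over compact subsets of $[0,\infty)$. If $f$ is real-valued, then, with the same sequence $(\tau_M)$, the same holds for $\tilde f^{(t)}_{M,n}(x)=\langle E^{(M)}_n\rangle_{\tilde\rho_{\Phi^t(x),\tau_M,n}}$. -/

import Mathlib

open Filter Topology MeasureTheory

noncomputable section

namespace QECD

/-! ### Classical level -/

instance fact_two_pi_pos : Fact (0 < 2 * Real.pi) := ⟨Real.two_pi_pos⟩

/-- The `d`-torus; a point is a `d`-tuple of angles modulo `2π`. -/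
abbrev Torus (d : ℕ) : Type := Fin d → AddCircle (2 * Real.pi)

/-- The Fourier function `φ_j(x) = ∏ᵢ exp(i jᵢ θⁱ)`. -/
def phi {d : ℕ} (j : Fin d → ℤ) (x : Torus d) : ℂ := ∏ i, fourier (j i) (x i)

/-- The torus rotation `Φᵗ(x) = (θ¹ + α₁ t, …, θᵈ + α_d t) mod 2π`. -/
def flow {d : ℕ} (α : Fin d → ℝ) (t : ℝ) (x : Torus d) : Torus d :=
  fun i => x i + ((α i * t : ℝ) : AddCircle (2 * Real.pi))

/-- The Koopman operator `Uᵗ f = f ∘ Φᵗ`. -/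
def koopman {d : ℕ} (α : Fin d → ℝ) (t : ℝ) (f : Torus d → ℂ) : Torus d → ℂ :=
  fun x => f (flow α t x)

/-- The normalized Haar measure on the torus. -/
def haarTorus (d : ℕ) : Measure (Torus d) := Measure.pi fun _ => AddCircle.haarAddCircle

/-- The Fourier coefficient `f̂_m = ∫ conj(φ_m) f dμ`. -/
def fhat {d : ℕ} (f : Torus d → ℂ) (m : Fin d → ℤ) : ℂ :=
  ∫ x, (starRingEnd ℂ) (phi m x) * f x ∂(haarTorus d)

/-- Membership in the Wiener algebra: `f` is the sum of its Fourier series, and this series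
converges absolutely. -/
structure IsWiener {d : ℕ} (f : Torus d → ℂ) : Prop where
  summable_norm : Summable fun m => ‖fhat f m‖
  hasSum : ∀ x, HasSum (fun m => fhat f m * phi m x) (f x)

/-- The bandlimited observable `f^(M) = ∑_{|m| ≤ M} f̂_m φ_m`, with `|m| = maxᵢ |mᵢ|`. -/
def bandlimit {d : ℕ} (f : Torus d → ℂ) (M : ℕ) (x : Torus d) : ℂ :=
  ∑ m ∈ Fintype.piFinset (fun _ : Fin d => Finset.Icc (-(M : ℤ)) (M : ℤ)), fhat f m * phi m x

/-! ### The finite-dimensional reproducing kernel Hilbert space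

Throughout, `q` is the number of qubits per torus dimension, so that the total number of qubits is
`n = d * q`. -/

/-- `|j|_p = |j₁|^p + … + |j_d|^p`. -/
def absP {d : ℕ} (p : ℝ) (j : Fin d → ℤ) : ℝ := ∑ i, |(j i : ℝ)| ^ p

/-- `ψ_j = exp(-τ |j|_p / 2) φ_j`. -/
def psi {d : ℕ} (p τ : ℝ) (j : Fin d → ℤ) (x : Torus d) : ℂ :=
  (Real.exp (-τ * absP p j / 2) : ℂ) * phi j x

/-- The one-dimensional index set `{-2^(q-1), …, -1, 1, …, 2^(q-1)}`. -/
def idx1 (q : ℕ) : Finset ℤ := (Finset.Icc (-2 ^ (q - 1)) (2 ^ (q - 1))).erase 0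

/-- The index set `J_n` for `n = d * q`: all multi-indices with entries in `idx1 q`. -/
def idx (d q : ℕ) : Finset (Fin d → ℤ) := Fintype.piFinset fun _ => idx1 q

/-- The Hilbert space `H_n = span {ψ_j : j ∈ J_n}` in which the `ψ_j` are orthonormal: an element
is given by its coefficients `c_j` in this basis, and represents the function `∑_j c_j ψ_j`
(see the `RKHS` instance below). -/
def HSpace (d q : ℕ) (_p _τ : ℝ) : Type := EuclideanSpace ℂ (idx d q)

section Instances

variable (d q : ℕ) (p τ : ℝ)

instance : NormedAddCommGroup (HSpace d q p τ) :=
  inferInstanceAs (NormedAddCommGroup (EuclideanSpace ℂ (idx d q)))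

instance : InnerProductSpace ℂ (HSpace d q p τ) :=
  inferInstanceAs (InnerProductSpace ℂ (EuclideanSpace ℂ (idx d q)))

instance : FiniteDimensional ℂ (HSpace d q p τ) :=
  inferInstanceAs (FiniteDimensional ℂ (EuclideanSpace ℂ (idx d q)))

instance : CompleteSpace (HSpace d q p τ) :=
  inferInstanceAs (CompleteSpace (EuclideanSpace ℂ (idx d q)))

end Instances

/-- The orthonormal basis of `H_n` formed by the functions `ψ_j`, `j ∈ J_n`. -/
def psiBasis (d q : ℕ) (p τ : ℝ) : OrthonormalBasis (idx d q) ℂ (HSpace d q p τ) :=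
  EuclideanSpace.basisFun (idx d q) ℂ

/-- The function on the torus represented by an element of `H_n`. -/
def evalCLM (d q : ℕ) (p τ : ℝ) : HSpace d q p τ →L[ℂ] (Torus d → ℂ) :=
  LinearMap.toContinuousLinearMap
    ((psiBasis d q p τ).toBasis.constr ℂ fun j => psi p τ (j : Fin d → ℤ))

/-- The Fourier function `φ_j` as a character of the torus. -/
def phiHom {d : ℕ} (j : Fin d → ℤ) : Multiplicative (Torus d) →* ℂ where
  toFun x := phi j x.toAdd
  map_one' := by simp [phi]
  map_mul' x y := by
    simp only [phi, toAdd_mul, Pi.add_apply, fourier_apply, smul_add, AddCircle.toCircle_add,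
      Circle.coe_mul, Finset.prod_mul_distrib]

theorem phiHom_injective {d : ℕ} :
    Function.Injective (phiHom : (Fin d → ℤ) → (Multiplicative (Torus d) →* ℂ)) := by
  intro j k h
  funext i
  have hf : (fourier (T := 2 * Real.pi) (j i)) = fourier (k i) := by
    ext z
    have := DFunLike.congr_fun h (Multiplicative.ofAdd (Pi.single i z : Torus d))
    simp only [phiHom, MonoidHom.coe_mk, OneHom.coe_mk, toAdd_ofAdd, phi] at this
    rw [Finset.prod_eq_single i, Finset.prod_eq_single i] at this
    · simpa using this
    all_goals simp +contextual
  exact (orthonormal_fourier (T := 2 * Real.pi)).linearIndependent.injective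
    (by simp only [fourierLp, hf])

theorem linearIndependent_phi {d : ℕ} :
    LinearIndependent ℂ (phi : (Fin d → ℤ) → Torus d → ℂ) :=
  (linearIndependent_monoidHom (Multiplicative (Torus d)) ℂ).comp phiHom phiHom_injective

theorem linearIndependent_psi {d : ℕ} (p τ : ℝ) :
    LinearIndependent ℂ (psi p τ : (Fin d → ℤ) → Torus d → ℂ) :=
  (linearIndependent_phi (d := d)).units_smul
    (fun j => Units.mk0 ((Real.exp (-τ * absP p j / 2) : ℝ) : ℂ)
      (by exact_mod_cast (Real.exp_pos _).ne'))

theorem evalCLM_injective (d q : ℕ) (p τ : ℝ) :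
    Function.Injective (evalCLM d q p τ : HSpace d q p τ → Torus d → ℂ) := by
  have h : LinearIndependent ℂ fun j : idx d q => psi (d := d) p τ (j : Fin d → ℤ) :=
    (linearIndependent_psi p τ).comp _ Subtype.val_injective
  exact (psiBasis d q p τ).toBasis.injective_constr_of_linearIndependent h

/-- `H_n` is a reproducing kernel Hilbert space of functions on the torus. -/
instance (d q : ℕ) (p τ : ℝ) : RKHS ℂ (HSpace d q p τ) (Torus d) ℂ where
  coeCLM := evalCLM d q p τ
  coeCLM_injective := evalCLM_injective d q p τ

/-- `κ_n = k_n(x, x) = ∑_{j ∈ J_n} exp(-τ |j|_p)`. -/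
def kappa (d q : ℕ) (p τ : ℝ) : ℝ := ∑ j ∈ idx d q, Real.exp (-τ * absP p j)

/-- The feature vector `k_{x,n} = k_n(x, ·)`: the section at `x` of the reproducing kernel of
`H_n`. -/
def feature (d q : ℕ) (p τ : ℝ) (x : Torus d) : HSpace d q p τ :=
  RKHS.kerFun (HSpace d q p τ) x 1

/-- The normalized feature vector `ξ_{x,n} = k_{x,n} / √κ_n`. -/
def xi (d q : ℕ) (p τ : ℝ) (x : Torus d) : HSpace d q p τ :=
  ((Real.sqrt (kappa d q p τ) : ℂ))⁻¹ • feature d q p τ x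

/-- The quantum feature map `x ↦ ρ_{x,n} = ⟨ξ_{x,n}, ·⟩ ξ_{x,n}`. -/
def rho (d q : ℕ) (p τ : ℝ) (x : Torus d) : HSpace d q p τ →L[ℂ] HSpace d q p τ :=
  InnerProductSpace.rankOne ℂ (xi d q p τ x) (xi d q p τ x)

/-! ### Quantum computational level -/

/-- The `n`-qubit Hilbert space `(ℂ²)^⊗n`, with its computational basis `|b⟩` indexed by the binary
strings `b` of length `n`. -/
abbrev Qubits (n : ℕ) : Type := EuclideanSpace ℂ (Fin n → Bool)

/-- The computational basis vector `|b⟩`. -/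
def ket {n : ℕ} (b : Fin n → Bool) : Qubits n := EuclideanSpace.single b 1

/-- The binary string of length `q` of an integer, most significant digit first. -/
def bits (q k : ℕ) : Fin q → Bool := fun i => k.testBit (q - 1 - i)

/-- The integer with the given binary string, most significant digit first. -/
def ofBits {q : ℕ} (b : Fin q → Bool) : ℕ := ∑ i, (b i).toNat * 2 ^ (q - 1 - (i : ℕ))

/-- The `i`-th of the `d` consecutive blocks of length `q` of a string of length `d * q`. -/
def block {d q : ℕ} (b : Fin (d * q) → Bool) (i : Fin d) : Fin q → Bool :=
  fun k => b (finProdFinEquiv (i, k))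

/-- The concatenation of `d` strings of length `q`. -/
def concat {d q : ℕ} (c : Fin d → Fin q → Bool) : Fin (d * q) → Bool :=
  fun l => c (finProdFinEquiv.symm l).1 (finProdFinEquiv.symm l).2

/-- The increasing enumeration of `{-2^(q-1), …, -1, 1, …, 2^(q-1)}` by `0, …, 2^q - 1`. -/
def enum (q : ℕ) (j : ℤ) : ℕ :=
  (if j < 0 then j + 2 ^ (q - 1) else j + 2 ^ (q - 1) - 1).toNat

/-- The binary encoding of a multi-index: the concatenation of the encodings of its entries. -/
def encode {d : ℕ} (q : ℕ) (j : Fin d → ℤ) : Fin (d * q) → Bool :=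
  concat fun i => bits q (enum q (j i))

/-- The map `W_n : H_n → (ℂ²)^⊗n` with `W_n ψ_j = |encode j⟩`; it is unitary for `q ≥ 1`. -/
def W (d q : ℕ) (p τ : ℝ) : HSpace d q p τ →L[ℂ] Qubits (d * q) :=
  LinearMap.toContinuousLinearMap
    ((psiBasis d q p τ).toBasis.constr ℂ fun j => ket (encode q (j : Fin d → ℤ)))

/-- The quantum computational state `ρ̂_{x,n} = W_n ρ_{x,n} W_n^*`. -/
def rhoHat (d q : ℕ) (p τ : ℝ) (x : Torus d) : Qubits (d * q) →L[ℂ] Qubits (d * q) :=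
  W d q p τ ∘L rho d q p τ x ∘L ContinuousLinearMap.adjoint (W d q p τ)

/-- The matrix of the `q`-qubit quantum Fourier transform
`|m⟩ ↦ 2^(-q/2) ∑_k exp(-2πi k m / 2^q) |k⟩`. -/
def qftMatrix (q : ℕ) : Matrix (Fin q → Bool) (Fin q → Bool) ℂ :=
  Matrix.of fun b c => ((Real.sqrt (2 ^ q) : ℝ) : ℂ)⁻¹ *
    Complex.exp (-2 * Real.pi * Complex.I * (ofBits b : ℂ) * (ofBits c : ℂ) / 2 ^ q)

/-- The `d`-fold tensor power of the `q`-qubit quantum Fourier transform. -/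
def qft (d q : ℕ) : Qubits (d * q) →L[ℂ] Qubits (d * q) :=
  Matrix.toEuclideanCLM (𝕜 := ℂ)
    (Matrix.of fun b c : Fin (d * q) → Bool => ∏ i, qftMatrix q (block b i) (block c i))

/-- The QFT-rotated state `ρ̃_{x,n} = F^* ρ̂_{x,n} F`, where `F = qft d q`. -/
def rhoTilde (d q : ℕ) (p τ : ℝ) (x : Torus d) : Qubits (d * q) →L[ℂ] Qubits (d * q) :=
  ContinuousLinearMap.adjoint (qft d q) ∘L rhoHat d q p τ x ∘L qft d q

/-- The grid point `x_b`, whose `i`-th angle is `2π / 2^q` times the integer encoded by the `i`-th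
block of `b`. -/
def gridPoint {d q : ℕ} (b : Fin (d * q) → Bool) : Torus d :=
  fun i => ((2 * Real.pi * (ofBits (block b i) : ℝ) / 2 ^ q : ℝ) : AddCircle (2 * Real.pi))

/-- The operator `|b⟩ ↦ g(b) |b⟩`, diagonal in the computational basis. -/
def diagOp {n : ℕ} (g : (Fin n → Bool) → ℂ) : Qubits n →L[ℂ] Qubits n :=
  Matrix.toEuclideanCLM (𝕜 := ℂ) (Matrix.diagonal g)

/-- The diagonal observable `D^(M)_n |b⟩ = f^(M)(x_b) |b⟩`. -/
def obsD {d : ℕ} (q : ℕ) (f : Torus d → ℂ) (M : ℕ) : Qubits (d * q) →L[ℂ] Qubits (d * q) :=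
  diagOp fun b => bandlimit f M (gridPoint b)

/-- The diagonal observable `E^(M)_n |b⟩ = Re f^(M)(x_b) |b⟩`. -/
def obsE {d : ℕ} (q : ℕ) (f : Torus d → ℂ) (M : ℕ) : Qubits (d * q) →L[ℂ] Qubits (d * q) :=
  diagOp fun b => ((bandlimit f M (gridPoint b)).re : ℂ)

/-- The quantum mechanical expectation `⟨A⟩_ρ = tr(ρ A)`. -/
def expect {n : ℕ} (ρ A : Qubits n →L[ℂ] Qubits n) : ℂ :=
  LinearMap.trace ℂ (Qubits n) ((ρ ∘L A : Qubits n →L[ℂ] Qubits n) : Qubits n →ₗ[ℂ] Qubits n)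

/-- The expected value of the time-`t` simulation of `f` from the initial condition `x`, with
`n = d * q` qubits, bandwidth `M`, and measurement of `D^(M)_n`. -/
def simD {d : ℕ} (p τ : ℝ) (α : Fin d → ℝ) (f : Torus d → ℂ) (M q : ℕ) (t : ℝ) (x : Torus d) : ℂ :=
  expect (rhoTilde d q p τ (flow α t x)) (obsD q f M)

/-- The same as `simD`, with measurement of `E^(M)_n`. -/
def simE {d : ℕ} (p τ : ℝ) (α : Fin d → ℝ) (f : Torus d → ℂ) (M q : ℕ) (t : ℝ) (x : Torus d) : ℂ :=
  expect (rhoTilde d q p τ (flow α t x)) (obsE q f M)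

/-- `lim_{M → ∞} lim_{q → ∞} F M q t x = G t x`, where the inner limits exist and both limits are
uniform for `x` in `X` and `t` in any compact subset of `[0, ∞)`. -/
def IteratedLimit {X : Type*} (F : ℕ → ℕ → ℝ → X → ℂ) (G : ℝ → X → ℂ) : Prop :=
  ∃ L : ℕ → ℝ → X → ℂ, ∀ K : Set ℝ, IsCompact K → K ⊆ Set.Ici 0 →
    (∀ M, TendstoUniformlyOn (fun q (z : ℝ × X) => F M q z.1 z.2) (fun z => L M z.1 z.2)
      atTop (K ×ˢ Set.univ)) ∧
    TendstoUniformlyOn (fun M (z : ℝ × X) => L M z.1 z.2) (fun z => G z.1 z.2)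
      atTop (K ×ˢ Set.univ)

end QECD

end

/-!
All sums over the index set and over the computational basis factor into products over the `d`
dimensions of the torus, so that everything is decided in dimension one. There, enumerate the
nonzero frequencies by integers `u`, without the gap at zero (`skipZero`). The Fourier-rotated
feature vector has at the grid point `k` the amplitude `∑ u, weight u * e^{-i (skipZero u) θ} *
e^{2πi u k / 2^q}` up to normalization and a phase, and by orthogonality of the characters of
`ℤ / 2^q` the expectation of `e^{imθ}` is a weighted average of `e^{i(l - j)θ}`, where `l` is
reached from `j` by `m` steps around the cycle of the `2^q` frequencies (`corr`,
`sum_normSq_amplitude`, `expect_phi`).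

As the number of qubits grows, the frequencies at which the cycle closes escape to infinity, where
the weights are summable; dominated convergence gives the inner limit (`tendsto_corr`). In the
limit `l - j = m`, except for at most `2|m| + 1` frequencies which cross zero. As `τ → 0` these
become negligible, because the normalization constant tends to infinity (`tendsto_kappaInf`), and
the weights at `j` and `l` become comparable uniformly in `j`, because `|·|^p` is subadditive for
`p ≤ 1` (`abs_weight_mul_sub_le`). Hence the expectation of `e^{imθ}` tends to `e^{imθ}`
(`tendsto_corrInf`). For each bandwidth `M` only finitely many Fourier functions occur, so `τ_M`
can be chosen with an error of at most `1 / (M + 1)` for the bandlimited observable, which itself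
converges to `f` uniformly (`IsWiener.exists_tendsto_sum_box`).

Limits are taken for the uniform norm in the spaces of continuous functions on the circle and on
the torus. They hold at all points, hence along the flow, uniformly in time. For real `f` the
bandlimited observable is real, so that the two measurements agree (`simE_eq_simD`).
-/

open Filter Topology MeasureTheory

noncomputable section

namespace QECD

/-! ### Weights and one-dimensional expectations -/

/-- The increasing bijection of `ℤ` onto `ℤ \ {0}` which fixes the negative integers. -/
def skipZero (u : ℤ) : ℤ := if u < 0 then u else u + 1

/-- The weight `exp(-τ |j|^p / 2)` at the frequency `j = skipZero u`. -/
def weight (p τ : ℝ) (u : ℤ) : ℝ := Real.exp (-τ * |(skipZero u : ℝ)| ^ p / 2)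

/-- The representative of `v` modulo `2^q` in `[-2^(q-1), 2^(q-1))`, for `q ≥ 1`. -/
def wrap (q : ℕ) (v : ℤ) : ℤ := (v + 2 ^ (q - 1)) % 2 ^ q - 2 ^ (q - 1)

/-- The integers in `[-2^(q-1), 2^(q-1))`. -/
def window (q : ℕ) : Finset ℤ := Finset.Ico (-2 ^ (q - 1)) (2 ^ (q - 1))

/-- The normalization constant `κ` in dimension one. -/
def kappaOne (q : ℕ) (p τ : ℝ) : ℝ := ∑ u ∈ window q, weight p τ u ^ 2

/-- The limit of `kappaOne` for infinitely many qubits. -/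
def kappaInf (p τ : ℝ) : ℝ := ∑' u, weight p τ u ^ 2

/-- The expectation of `e^{imθ}` with `q` qubits in dimension one, as a function of the
angle `θ`: a weighted average of `e^{i(l-j)θ}`, where the frequency `l` is reached from `j` by `m` steps
around the cycle of the `2^q` available frequencies. -/
def corr (q : ℕ) (p τ : ℝ) (m : ℤ) : C(AddCircle (2 * Real.pi), ℂ) :=
  (kappaOne q p τ : ℂ)⁻¹ • ∑ u ∈ window q,
    ((weight p τ u * weight p τ (wrap q (u + m)) : ℝ) : ℂ) •
      fourier (skipZero (wrap q (u + m)) - skipZero u)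

/-- The limit of `corr` for infinitely many qubits, where the frequencies no longer wrap around. -/
def corrInf (p τ : ℝ) (m : ℤ) : C(AddCircle (2 * Real.pi), ℂ) :=
  (kappaInf p τ : ℂ)⁻¹ • ∑' u : ℤ,
    ((weight p τ u * weight p τ (u + m) : ℝ) : ℂ) • fourier (skipZero (u + m) - skipZero u)

theorem weight_pos (p τ : ℝ) (u : ℤ) : 0 < weight p τ u := Real.exp_pos _

theorem weight_le_one {p τ : ℝ} (hτ : 0 ≤ τ) (u : ℤ) : weight p τ u ≤ 1 := by
  have : 0 ≤ τ * |(skipZero u : ℝ)| ^ p := by positivity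
  exact Real.exp_le_one_iff.2 (by linarith)

theorem abs_le_abs_skipZero (u : ℤ) : |(u : ℝ)| ≤ |(skipZero u : ℝ)| := by
  have : |u| ≤ |skipZero u| := by
    rw [Int.abs_eq_natAbs, Int.abs_eq_natAbs]
    unfold skipZero; split_ifs <;> omega
  exact_mod_cast this

theorem summable_exp_neg_mul_rpow {p c : ℝ} (hp : 0 < p) (hc : 0 < c) :
    Summable fun u : ℤ => Real.exp (-c * |(u : ℝ)| ^ p) := by
  have hnat : Summable fun n : ℕ => Real.exp (-c * (n : ℝ) ^ p) := by
    have h1 := (isLittleO_exp_neg_mul_rpow_atTop hc (-2 / p)).comp_tendsto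
      ((tendsto_rpow_atTop hp).comp tendsto_natCast_atTop_atTop)
    refine summable_of_isBigO_nat (g := fun n : ℕ => (n : ℝ) ^ (-2 : ℝ)) ?_ ?_
    · exact Real.summable_nat_rpow.2 (by norm_num)
    · refine h1.isBigO.congr_right fun n => ?_
      simp only [Function.comp_apply]
      rw [← Real.rpow_mul (by positivity)]
      congr 1
      field_simp
  refine Summable.of_nat_of_neg ?_ ?_ <;> simpa using hnat

theorem summable_weight {p τ : ℝ} (hp : 0 < p) (hτ : 0 < τ) : Summable (weight p τ) := by
  refine (summable_exp_neg_mul_rpow hp (half_pos hτ)).of_nonneg_of_le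
    (fun u => (weight_pos p τ u).le) fun u => Real.exp_le_exp.2 ?_
  have := Real.rpow_le_rpow (abs_nonneg _) (abs_le_abs_skipZero u) hp.le
  nlinarith

theorem weight_sq_le {p τ : ℝ} (hτ : 0 ≤ τ) (u : ℤ) : weight p τ u ^ 2 ≤ weight p τ u := by
  have := weight_le_one (p := p) hτ u
  have := weight_pos p τ u
  nlinarith

theorem summable_weight_sq {p τ : ℝ} (hp : 0 < p) (hτ : 0 < τ) :
    Summable fun u => weight p τ u ^ 2 :=
  (summable_weight hp hτ).of_nonneg_of_le (fun _ => sq_nonneg _) (weight_sq_le hτ.le)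

theorem kappaInf_pos {p τ : ℝ} (hp : 0 < p) (hτ : 0 < τ) : 0 < kappaInf p τ :=
  (summable_weight_sq hp hτ).tsum_pos (fun _ => sq_nonneg _) 0 (pow_pos (weight_pos _ _ _) 2)

theorem mem_window {q : ℕ} {u : ℤ} : u ∈ window q ↔ -2 ^ (q - 1) ≤ u ∧ u < 2 ^ (q - 1) :=
  Finset.mem_Ico

theorem two_pow_eq {q : ℕ} (hq : 1 ≤ q) : (2 : ℤ) ^ q = 2 * 2 ^ (q - 1) := by
  rw [← pow_succ', Nat.sub_add_cancel hq]

theorem wrap_of_mem {q : ℕ} (hq : 1 ≤ q) {u : ℤ} (hu : u ∈ window q) : wrap q u = u := by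
  rw [mem_window] at hu
  unfold wrap
  rw [two_pow_eq hq, Int.emod_eq_of_lt] <;> omega

theorem wrap_mem {q : ℕ} (hq : 1 ≤ q) (u : ℤ) : wrap q u ∈ window q := by
  have hN : (0 : ℤ) < 2 ^ q := by positivity
  have h1 := Int.emod_nonneg (u + 2 ^ (q - 1)) hN.ne'
  have h2 := Int.emod_lt_of_pos (u + 2 ^ (q - 1)) hN
  have h3 := two_pow_eq hq
  rw [mem_window]
  unfold wrap
  constructor <;> omega

theorem eventually_mem_window (u : ℤ) : ∀ᶠ q in atTop, u ∈ window q := by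
  filter_upwards [eventually_ge_atTop (u.natAbs + 1)] with q hq
  have h1 : u.natAbs < 2 ^ u.natAbs := Nat.lt_two_pow_self
  have h2 : 2 ^ u.natAbs ≤ 2 ^ (q - 1) := Nat.pow_le_pow_right (by norm_num) (by omega)
  have h3 : (u.natAbs : ℤ) < 2 ^ (q - 1) := by exact_mod_cast h1.trans_le h2
  rw [mem_window]
  omega

theorem tendsto_kappaOne {p τ : ℝ} (hp : 0 < p) (hτ : 0 < τ) :
    Tendsto (fun q => kappaOne q p τ) atTop (𝓝 (kappaInf p τ)) := by
  have hsum : ∀ q, kappaOne q p τ = ∑' u, if u ∈ window q then weight p τ u ^ 2 else 0 := by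
    intro q
    rw [tsum_eq_sum (s := window q) (fun u hu => if_neg hu)]
    exact Finset.sum_congr rfl fun u hu => (if_pos hu).symm
  simp_rw [hsum]
  refine tendsto_tsum_of_dominated_convergence (summable_weight_sq hp hτ) (fun u => ?_)
    (Eventually.of_forall fun q u => ?_)
  · refine tendsto_const_nhds.congr' ?_
    filter_upwards [eventually_mem_window u] with q hq
    rw [if_pos hq]
  · split_ifs
    · simp
    · simpa using sq_nonneg _

theorem norm_weight_smul_fourier (p τ : ℝ) (u v k : ℤ) :
    ‖((weight p τ u * weight p τ v : ℝ) : ℂ) • (fourier k : C(AddCircle (2 * Real.pi), ℂ))‖ =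
      weight p τ u * weight p τ v := by
  rw [norm_smul, fourier_norm, mul_one, Complex.norm_real, Real.norm_eq_abs,
    abs_of_pos (mul_pos (weight_pos _ _ _) (weight_pos _ _ _))]

/-- The wrapped frequencies escape to infinity, so that by dominated convergence they do not
contribute in the limit of infinitely many qubits. -/
theorem tendsto_corr {p τ : ℝ} (hp : 0 < p) (hτ : 0 < τ) (m : ℤ) :
    Tendsto (fun q => corr q p τ m) atTop (𝓝 (corrInf p τ m)) := by
  refine Tendsto.smul ?_ ?_
  · exact ((Complex.continuous_ofReal.tendsto _).comp (tendsto_kappaOne hp hτ)).inv₀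
      (by exact_mod_cast (kappaInf_pos hp hτ).ne')
  · have hsum : ∀ q, (∑ u ∈ window q,
        ((weight p τ u * weight p τ (wrap q (u + m)) : ℝ) : ℂ) •
          (fourier (skipZero (wrap q (u + m)) - skipZero u) : C(AddCircle (2 * Real.pi), ℂ))) =
        ∑' u, if u ∈ window q then
          ((weight p τ u * weight p τ (wrap q (u + m)) : ℝ) : ℂ) •
            (fourier (skipZero (wrap q (u + m)) - skipZero u) : C(AddCircle (2 * Real.pi), ℂ))
          else 0 := by
      intro q
      rw [tsum_eq_sum (s := window q) (fun u hu => if_neg hu)]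
      exact Finset.sum_congr rfl fun u hu => (if_pos hu).symm
    simp_rw [hsum]
    refine tendsto_tsum_of_dominated_convergence (summable_weight hp hτ) (fun u => ?_)
      (Eventually.of_forall fun q u => ?_)
    · refine tendsto_const_nhds.congr' ?_
      filter_upwards [eventually_mem_window u, eventually_mem_window (u + m),
        eventually_ge_atTop 1] with q hq hq' hq1
      rw [if_pos hq, wrap_of_mem hq1 hq']
    · split_ifs
      · rw [norm_weight_smul_fourier]
        exact mul_le_of_le_one_right (weight_pos _ _ _).le (weight_le_one hτ.le _)
      · simpa using (weight_pos p τ u).le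

/-! ### The limit of small `τ` -/

theorem tendsto_kappaInf {p : ℝ} (hp : 0 < p) :
    Tendsto (kappaInf p) (𝓝[>] 0) atTop := by
  refine tendsto_atTop.2 fun b => ?_
  obtain ⟨n, hn⟩ := exists_nat_gt b
  -- the terms of the series with index in `[0, n)` all tend to `1`
  have hcont : Tendsto (fun τ : ℝ => ∑ k ∈ Finset.Ico (0 : ℤ) n, weight p τ k ^ 2) (𝓝[>] 0)
      (𝓝 n) := by
    have : Continuous fun τ : ℝ => ∑ k ∈ Finset.Ico (0 : ℤ) n, weight p τ k ^ 2 := by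
      unfold weight; fun_prop
    have h := (this.tendsto 0).mono_left (nhdsWithin_le_nhds (s := Set.Ioi 0))
    simpa [weight] using h
  filter_upwards [hcont.eventually (lt_mem_nhds hn), self_mem_nhdsWithin] with τ h hτ
  exact h.le.trans ((summable_weight_sq hp hτ).sum_le_tsum _ fun _ _ => sq_nonneg _)

theorem abs_exp_sub_one_le {s δ : ℝ} (h : |s| ≤ δ) : |Real.exp s - 1| ≤ Real.exp δ - 1 := by
  have h1 := abs_le.1 h
  have h2 := Real.exp_le_exp.2 h1.2
  have h3 := Real.add_one_le_exp s
  have h4 := Real.add_one_le_exp δ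
  rw [abs_le]
  constructor <;> linarith

theorem abs_abs_rpow_sub_le {p : ℝ} (hp0 : 0 ≤ p) (hp1 : p ≤ 1) (a b : ℝ) :
    |(|a| ^ p - |b| ^ p)| ≤ |a - b| ^ p := by
  have key : ∀ x y : ℝ, |x| ^ p ≤ |x - y| ^ p + |y| ^ p := fun x y =>
    (Real.rpow_le_rpow (abs_nonneg _) (by simpa using abs_add_le (x - y) y) hp0).trans
      (Real.rpow_add_le_add_rpow (abs_nonneg _) (abs_nonneg _) hp0 hp1)
  have h1 := key a b
  have h2 := key b a
  rw [abs_sub_comm b a] at h2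
  rw [abs_le]
  constructor <;> linarith

/-- Since `|·|^p` is subadditive, a shift by `m` changes the weights by a factor which tends to
one as `τ → 0`, uniformly over all frequencies. -/
theorem abs_weight_mul_sub_le {p τ : ℝ} (hp0 : 0 < p) (hp1 : p ≤ 1) (hτ : 0 ≤ τ) (u m : ℤ) :
    |weight p τ u * weight p τ (u + m) - weight p τ u ^ 2| ≤
      weight p τ u ^ 2 * (Real.exp (τ * (|(m : ℝ)| + 1) ^ p / 2) - 1) := by
  set a : ℝ := |(skipZero u : ℝ)| ^ p
  set b : ℝ := |(skipZero (u + m) : ℝ)| ^ p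
  have hw : weight p τ (u + m) = weight p τ u * Real.exp (τ * (a - b) / 2) := by
    unfold weight
    rw [← Real.exp_add]
    congr 1
    ring
  have hab : |a - b| ≤ (|(m : ℝ)| + 1) ^ p := by
    refine (abs_abs_rpow_sub_le hp0.le hp1 _ _).trans
      (Real.rpow_le_rpow (abs_nonneg _) ?_ hp0.le)
    have : |skipZero u - skipZero (u + m)| ≤ |m| + 1 := by
      rw [Int.abs_eq_natAbs, Int.abs_eq_natAbs]
      unfold skipZero; split_ifs <;> omega
    exact_mod_cast this
  rw [hw, show weight p τ u * (weight p τ u * Real.exp (τ * (a - b) / 2)) - weight p τ u ^ 2 =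
    weight p τ u ^ 2 * (Real.exp (τ * (a - b) / 2) - 1) by ring, abs_mul,
    abs_of_nonneg (sq_nonneg _)]
  refine mul_le_mul_of_nonneg_left (abs_exp_sub_one_le ?_) (sq_nonneg _)
  rw [abs_div, abs_mul, abs_of_nonneg hτ, abs_two]
  gcongr

/-- In one dimension, the expectation of `e^{imθ}` differs from its true value for two reasons:
the weights vary, and the frequencies which cross zero are shifted by one step too many or too
few. There are at most `2|m| + 1` of the latter. -/
theorem norm_corrInf_sub_le {p τ : ℝ} (hp0 : 0 < p) (hp1 : p ≤ 1) (hτ : 0 < τ) (m : ℤ) :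
    ‖corrInf p τ m - fourier m‖ ≤ (Real.exp (τ * (|(m : ℝ)| + 1) ^ p / 2) - 1) +
      (kappaInf p τ)⁻¹ * ∑ _u ∈ Finset.Icc (-|m|) |m|, 2 := by
  set δ := Real.exp (τ * (|(m : ℝ)| + 1) ^ p / 2) - 1 with hδ
  have hκ := kappaInf_pos hp0 hτ
  have hκ' : (kappaInf p τ : ℂ) ≠ 0 := by exact_mod_cast hκ.ne'
  set A : ℤ → C(AddCircle (2 * Real.pi), ℂ) := fun u =>
    ((weight p τ u * weight p τ (u + m) : ℝ) : ℂ) • fourier (skipZero (u + m) - skipZero u) with hA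
  set B : ℤ → C(AddCircle (2 * Real.pi), ℂ) := fun u =>
    ((weight p τ u ^ 2 : ℝ) : ℂ) • fourier m with hB
  set c : ℤ → ℝ := fun u => if u ∈ Finset.Icc (-|m|) |m| then 2 else 0 with hc
  have hAs : Summable A := by
    refine .of_norm ((summable_weight hp0 hτ).of_nonneg_of_le (fun _ => norm_nonneg _) fun u => ?_)
    rw [hA, norm_weight_smul_fourier]
    exact mul_le_of_le_one_right (weight_pos _ _ _).le (weight_le_one hτ.le _)
  have hBs : HasSum B ((kappaInf p τ : ℂ) • fourier m) :=
    (Complex.hasSum_ofReal.2 (summable_weight_sq hp0 hτ).hasSum).smul_const _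
  have hcs : HasSum c (∑ _u ∈ Finset.Icc (-|m|) |m|, 2) := by
    rw [Finset.sum_congr rfl (fun u hu => (if_pos hu).symm :
      ∀ u ∈ Finset.Icc (-|m|) |m|, (2 : ℝ) = c u)]
    exact hasSum_sum_of_ne_finset_zero fun u hu => if_neg hu
  have hterm : ∀ u, ‖A u - B u‖ ≤ weight p τ u ^ 2 * δ + c u := by
    intro u
    have hsplit : A u - B u =
        ((weight p τ u * weight p τ (u + m) - weight p τ u ^ 2 : ℝ) : ℂ) •
          (fourier (skipZero (u + m) - skipZero u) : C(AddCircle (2 * Real.pi), ℂ)) +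
        ((weight p τ u ^ 2 : ℝ) : ℂ) •
          (fourier (skipZero (u + m) - skipZero u) - fourier m) := by
      simp only [hA, hB, smul_sub, Complex.ofReal_sub, sub_smul]
      abel
    rw [hsplit]
    refine (norm_add_le _ _).trans (add_le_add ?_ ?_)
    · rw [norm_smul, fourier_norm, mul_one, Complex.norm_real, Real.norm_eq_abs]
      exact abs_weight_mul_sub_le hp0 hp1 hτ.le u m
    · rw [norm_smul, Complex.norm_real, Real.norm_eq_abs, abs_of_nonneg (sq_nonneg _)]
      by_cases hu : u ∈ Finset.Icc (-|m|) |m|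
      · have h1 : weight p τ u ^ 2 ≤ 1 :=
          (weight_sq_le hτ.le u).trans (weight_le_one hτ.le u)
        have h2 : ‖(fourier (skipZero (u + m) - skipZero u) - fourier m :
            C(AddCircle (2 * Real.pi), ℂ))‖ ≤ 2 := by
          refine (norm_sub_le _ _).trans ?_
          rw [fourier_norm, fourier_norm]
          norm_num
        rw [hc]
        simp only [if_pos hu]
        nlinarith [norm_nonneg (fourier (skipZero (u + m) - skipZero u) - fourier m :
            C(AddCircle (2 * Real.pi), ℂ)), sq_nonneg (weight p τ u)]
      · have : skipZero (u + m) - skipZero u = m := by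
          rw [Finset.mem_Icc, Int.abs_eq_natAbs] at hu
          unfold skipZero; split_ifs <;> omega
        rw [this, sub_self, norm_zero, mul_zero, hc]
        simp only [if_neg hu, le_refl]
  have hsum := ((summable_weight_sq hp0 hτ).hasSum.mul_right δ).add hcs
  have heq : corrInf p τ m - fourier m = (kappaInf p τ : ℂ)⁻¹ • ∑' u, (A u - B u) := by
    rw [hAs.tsum_sub hBs.summable, hBs.tsum_eq, smul_sub, inv_smul_smul₀ hκ']
    rfl
  rw [heq, norm_smul, norm_inv, Complex.norm_real, Real.norm_eq_abs, abs_of_pos hκ]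
  calc (kappaInf p τ)⁻¹ * ‖∑' u, (A u - B u)‖
      ≤ (kappaInf p τ)⁻¹ * (kappaInf p τ * δ + ∑ _u ∈ Finset.Icc (-|m|) |m|, 2) := by
        gcongr
        exact tsum_of_norm_bounded hsum hterm
    _ = _ := by
        rw [mul_add, inv_mul_cancel_left₀ hκ.ne']

theorem tendsto_corrInf {p : ℝ} (hp0 : 0 < p) (hp1 : p ≤ 1) (m : ℤ) :
    Tendsto (fun τ => corrInf p τ m) (𝓝[>] 0) (𝓝 (fourier m)) := by
  rw [tendsto_iff_norm_sub_tendsto_zero]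
  refine squeeze_zero' (Eventually.of_forall fun _ => norm_nonneg _)
    (eventually_mem_nhdsWithin.mono fun τ hτ => norm_corrInf_sub_le hp0 hp1 hτ m) ?_
  have h1 : Tendsto (fun τ : ℝ => Real.exp (τ * (|(m : ℝ)| + 1) ^ p / 2) - 1) (𝓝[>] 0) (𝓝 0) := by
    have : Continuous fun τ : ℝ => Real.exp (τ * (|(m : ℝ)| + 1) ^ p / 2) - 1 := by fun_prop
    simpa using (this.tendsto 0).mono_left (nhdsWithin_le_nhds (s := Set.Ioi 0))
  simpa using h1.add ((tendsto_inv_atTop_zero.comp (tendsto_kappaInf hp0)).mul_const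
    (∑ _u ∈ Finset.Icc (-|m|) |m|, (2 : ℝ)))

/-! ### Binary strings and orthogonality of characters -/

theorem sum_testBit_mul_two_pow (q k : ℕ) :
    ∑ i ∈ Finset.range q, (k.testBit i).toNat * 2 ^ i = k % 2 ^ q := by
  induction q with
  | zero => simp [Nat.mod_one]
  | succ n ih =>
    rw [Finset.sum_range_succ, ih, Nat.mod_pow_succ, Nat.toNat_testBit, mul_comm]

theorem ofBits_bits {q k : ℕ} (hk : k < 2 ^ q) : ofBits (bits q k) = k := by
  unfold ofBits bits
  rw [Fin.sum_univ_eq_sum_range (fun i => (k.testBit (q - 1 - i)).toNat * 2 ^ (q - 1 - i)) q,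
    Finset.sum_range_reflect (fun i => (k.testBit i).toNat * 2 ^ i) q, sum_testBit_mul_two_pow,
    Nat.mod_eq_of_lt hk]

theorem sum_ofBits {β : Type*} [AddCommMonoid β] (q : ℕ) (g : ℕ → β) :
    ∑ c : Fin q → Bool, g (ofBits c) = ∑ k ∈ Finset.range (2 ^ q), g k := by
  rw [← Fin.sum_univ_eq_sum_range]
  have hinj : Function.Injective fun k : Fin (2 ^ q) => bits q k := fun k l h => by
    have := congrArg ofBits h
    rw [ofBits_bits k.2, ofBits_bits l.2] at this
    exact Fin.ext this
  have hbij : Function.Bijective fun k : Fin (2 ^ q) => bits q k :=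
    (Fintype.bijective_iff_injective_and_card _).2 ⟨hinj, by simp⟩
  exact (hbij.sum_comp (fun c => g (ofBits c))).symm.trans
    (Finset.sum_congr rfl fun k _ => by rw [ofBits_bits k.2])

theorem block_concat {d q : ℕ} (c : Fin d → Fin q → Bool) (i : Fin d) :
    block (concat c) i = c i := by
  ext k
  simp [block, concat]

theorem concat_block {d q : ℕ} (b : Fin (d * q) → Bool) : concat (block b) = b := by
  ext l
  simp [block, concat, -finProdFinEquiv_symm_apply]

theorem sum_prod_block {d q : ℕ} (g : Fin d → (Fin q → Bool) → ℂ) :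
    ∑ b : Fin (d * q) → Bool, ∏ i, g i (block b i) = ∏ i, ∑ c, g i c := by
  rw [Finset.prod_univ_sum, Fintype.piFinset_univ]
  exact Fintype.sum_equiv
    { toFun := block, invFun := concat, left_inv := concat_block,
      right_inv := fun c => funext (block_concat c) } _ _ fun _ => rfl

/-- Orthogonality of the characters of `ℤ / N`. -/
theorem sum_exp_two_pi {N : ℕ} (hN : N ≠ 0) (a : ℤ) :
    ∑ k ∈ Finset.range N, Complex.exp (2 * Real.pi * Complex.I * a * k / N) =
      if (N : ℤ) ∣ a then (N : ℂ) else 0 := by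
  have hN' : (N : ℂ) ≠ 0 := Nat.cast_ne_zero.2 hN
  set z := Complex.exp (2 * Real.pi * Complex.I * a / N) with hz
  have hpow : ∀ k : ℕ, Complex.exp (2 * Real.pi * Complex.I * a * k / N) = z ^ k := fun k => by
    rw [hz, ← Complex.exp_nat_mul]
    congr 1
    ring
  simp_rw [hpow]
  have hz1 : z = 1 ↔ (N : ℤ) ∣ a := by
    rw [hz, Complex.exp_eq_one_iff]
    refine exists_congr fun n => ?_
    have h : (2 * Real.pi * Complex.I * a / N = n * (2 * Real.pi * Complex.I)) ↔
        (a : ℂ) = N * n := by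
      have := Complex.two_pi_I_ne_zero
      rw [div_eq_iff hN', mul_comm (_ : ℂ) (a : ℂ), show (n : ℂ) * (2 * Real.pi * Complex.I) * N =
        N * n * (2 * Real.pi * Complex.I) by ring]
      exact mul_left_inj' this
    rw [h]
    exact_mod_cast Iff.rfl
  have hzN : z ^ N = 1 := by
    rw [← hpow, mul_div_cancel_right₀ _ hN']
    exact Complex.exp_eq_one_iff.2 ⟨a, by ring⟩
  split_ifs with h
  · simp [hz1.2 h]
  · rw [geom_sum_eq (mt hz1.1 h), hzN, sub_self, zero_div]

/-! ### Expectations of Fourier functions -/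

/-- The amplitude of `|k⟩` in the Fourier-rotated feature vector at the angle `θ`, in dimension one,
without the factor `κ^(-1/2)`. The frequency `skipZero u` is encoded by `u + 2^(q-1)`. -/
def amplitude (q : ℕ) (p τ : ℝ) (θ : AddCircle (2 * Real.pi)) (k : ℕ) : ℂ :=
  ∑ u ∈ window q, weight p τ u * (starRingEnd ℂ) (fourier (skipZero u) θ) *
    (((Real.sqrt (2 ^ q) : ℝ) : ℂ)⁻¹ *
      Complex.exp (2 * Real.pi * Complex.I * ((u + 2 ^ (q - 1) : ℤ) : ℂ) * k / 2 ^ q))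

theorem sum_idx1 {β : Type*} [AddCommMonoid β] (q : ℕ) (g : ℤ → β) :
    ∑ j ∈ idx1 q, g j = ∑ u ∈ window q, g (skipZero u) := by
  symm
  refine Finset.sum_nbij' skipZero (fun j => if j < 0 then j else j - 1) ?_ ?_ ?_ ?_
    (fun _ _ => rfl)
  all_goals
    intro u hu
    simp only [idx1, mem_window, Finset.mem_erase, Finset.mem_Icc, skipZero] at hu ⊢
    split_ifs <;> omega

theorem kappa_eq (d q : ℕ) (p τ : ℝ) : kappa d q p τ = kappaOne q p τ ^ d := by
  have h1 : kappaOne q p τ = ∑ j ∈ idx1 q, Real.exp (-τ * |(j : ℝ)| ^ p) := by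
    rw [sum_idx1, kappaOne]
    refine Finset.sum_congr rfl fun u _ => ?_
    rw [weight, ← Real.exp_nat_mul]
    congr 1
    push_cast
    ring
  rw [h1, ← Fin.prod_const, Finset.prod_univ_sum, kappa, idx]
  refine Finset.sum_congr rfl fun j _ => ?_
  rw [← Real.exp_sum, absP, Finset.mul_sum]

theorem kappaOne_pos {q : ℕ} (p τ : ℝ) : 0 < kappaOne q p τ :=
  Finset.sum_pos (fun u _ => pow_pos (weight_pos p τ u) 2)
    ⟨0, by rw [mem_window]; constructor <;> simp⟩

theorem feature_eq (d q : ℕ) (p τ : ℝ) (x : Torus d) :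
    feature d q p τ x =
      ∑ j : idx d q, (starRingEnd ℂ) (psi p τ (j : Fin d → ℤ) x) • psiBasis d q p τ j := by
  rw [← (psiBasis d q p τ).sum_repr (feature d q p τ x)]
  refine Finset.sum_congr rfl fun j _ => ?_
  rw [(psiBasis d q p τ).repr_apply_apply, feature, RKHS.inner_kerFun]
  have : (psiBasis d q p τ j : HSpace d q p τ) x = psi p τ (j : Fin d → ℤ) x := by
    have h : evalCLM d q p τ (psiBasis d q p τ j) = psi p τ (j : Fin d → ℤ) := by
      simpa only [evalCLM, LinearMap.coe_toContinuousLinearMap', OrthonormalBasis.coe_toBasis] using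
        (psiBasis d q p τ).toBasis.constr_basis ℂ
          (fun j : idx d q => psi (d := d) p τ (j : Fin d → ℤ)) j
    exact congrFun h x
  rw [this]
  simp

theorem W_psiBasis (d q : ℕ) (p τ : ℝ) (j : idx d q) :
    W d q p τ (psiBasis d q p τ j) = ket (encode q (j : Fin d → ℤ)) := by
  simpa only [W, LinearMap.coe_toContinuousLinearMap', OrthonormalBasis.coe_toBasis] using
    (psiBasis d q p τ).toBasis.constr_basis ℂ
      (fun j : idx d q => ket (encode q (j : Fin d → ℤ))) j

theorem enum_skipZero {q : ℕ} {u : ℤ} (hu : u ∈ window q) :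
    (enum q (skipZero u) : ℤ) = u + 2 ^ (q - 1) := by
  rw [mem_window] at hu
  unfold enum skipZero
  split_ifs <;> omega

theorem enum_skipZero_lt {q : ℕ} (hq : 1 ≤ q) {u : ℤ} (hu : u ∈ window q) :
    enum q (skipZero u) < 2 ^ q := by
  have h1 := enum_skipZero hu
  have h2 := two_pow_eq hq
  rw [mem_window] at hu
  have : (enum q (skipZero u) : ℤ) < 2 ^ q := by omega
  exact_mod_cast this

theorem conj_qftMatrix (q : ℕ) (b c : Fin q → Bool) :
    (starRingEnd ℂ) (qftMatrix q b c) = ((Real.sqrt (2 ^ q) : ℝ) : ℂ)⁻¹ *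
      Complex.exp (2 * Real.pi * Complex.I * (ofBits b : ℂ) * (ofBits c : ℂ) / 2 ^ q) := by
  rw [qftMatrix, Matrix.of_apply, map_mul, map_inv₀, Complex.conj_ofReal, ← Complex.exp_conj]
  simp [map_ofNat (starRingEnd ℂ) 2]

/-- The Fourier-rotated feature vector is a product state. -/
theorem rotated_xi_apply {d q : ℕ} (hq : 1 ≤ q) (p τ : ℝ) (x : Torus d)
    (b : Fin (d * q) → Bool) :
    ContinuousLinearMap.adjoint (qft d q) (W d q p τ (xi d q p τ x)) b =
      ((Real.sqrt (kappa d q p τ) : ℝ) : ℂ)⁻¹ *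
        ∏ i, amplitude q p τ (x i) (ofBits (block b i)) := by
  have hadj : ContinuousLinearMap.adjoint (qft d q) = Matrix.toEuclideanCLM (𝕜 := ℂ)
      (Matrix.of fun b c : Fin (d * q) → Bool =>
        ∏ i, qftMatrix q (block b i) (block c i)).conjTranspose := by
    rw [← ContinuousLinearMap.star_eq_adjoint, qft, ← Matrix.star_eq_conjTranspose, map_star]
  have hket : ∀ c : Fin (d * q) → Bool, ContinuousLinearMap.adjoint (qft d q) (ket c) b =
      ∏ i, (starRingEnd ℂ) (qftMatrix q (block c i) (block b i)) := by
    intro c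
    rw [hadj, ket, Matrix.ofLp_toEuclideanCLM]
    simp [Matrix.conjTranspose_apply]
  have hone : ∀ i, amplitude q p τ (x i) (ofBits (block b i)) =
      ∑ j ∈ idx1 q, (Real.exp (-τ * |(j : ℝ)| ^ p / 2) : ℂ) *
        (starRingEnd ℂ) (fourier j (x i)) *
        (starRingEnd ℂ) (qftMatrix q (bits q (enum q j)) (block b i)) := by
    intro i
    rw [sum_idx1, amplitude]
    refine Finset.sum_congr rfl fun u hu => ?_
    rw [conj_qftMatrix, ofBits_bits (enum_skipZero_lt hq hu), ← enum_skipZero hu, weight]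
    push_cast
    rfl
  simp_rw [hone]
  rw [Finset.prod_univ_sum, xi, feature_eq]
  simp only [map_smul, map_sum, W_psiBasis, PiLp.smul_apply, WithLp.ofLp_sum, Finset.sum_apply,
    hket, smul_eq_mul]
  congr 1
  rw [Finset.sum_coe_sort (idx d q) (fun j => (starRingEnd ℂ) (psi p τ j x) *
    ∏ i, (starRingEnd ℂ) (qftMatrix q (block (encode q j) i) (block b i)))]
  refine Finset.sum_congr rfl fun j _ => ?_
  rw [Finset.prod_mul_distrib, Finset.prod_mul_distrib]
  congr 1
  · rw [psi, map_mul, Complex.conj_ofReal, phi, map_prod]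
    congr 1
    rw [← Complex.ofReal_prod, ← Real.exp_sum, absP, Finset.mul_sum, Finset.sum_div]
  · simp only [encode, block_concat]

theorem expect_rhoTilde_diagOp (d q : ℕ) (p τ : ℝ) (x : Torus d)
    (g : (Fin (d * q) → Bool) → ℂ) :
    expect (rhoTilde d q p τ x) (diagOp g) =
      ∑ b, (starRingEnd ℂ) (ContinuousLinearMap.adjoint (qft d q) (W d q p τ (xi d q p τ x)) b) *
        ContinuousLinearMap.adjoint (qft d q) (W d q p τ (xi d q p τ x)) b * g b := by
  set v := ContinuousLinearMap.adjoint (qft d q) (W d q p τ (xi d q p τ x)) with hv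
  have hrho : rhoTilde d q p τ x = InnerProductSpace.rankOne ℂ v v := by
    rw [rhoTilde, rhoHat, rho, InnerProductSpace.rankOne_comp,
      ContinuousLinearMap.adjoint_adjoint, InnerProductSpace.comp_rankOne,
      InnerProductSpace.rankOne_comp, InnerProductSpace.comp_rankOne]
  rw [expect, hrho, InnerProductSpace.rankOne_comp, InnerProductSpace.trace_rankOne,
    ContinuousLinearMap.adjoint_inner_left, PiLp.inner_apply]
  refine Finset.sum_congr rfl fun b _ => ?_
  rw [diagOp, Matrix.ofLp_toEuclideanCLM, Matrix.mulVec_diagonal]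
  simp only [RCLike.inner_apply]
  ring

/-- By orthogonality of characters, measuring `e^{imθ}` on the grid couples the frequencies `u` and
`v` exactly when `v ≡ u + m` modulo `2^q`. -/
theorem sum_normSq_amplitude {q : ℕ} (hq : 1 ≤ q) (p τ : ℝ) (θ : AddCircle (2 * Real.pi))
    (m : ℤ) :
    ∑ k ∈ Finset.range (2 ^ q), (starRingEnd ℂ) (amplitude q p τ θ k) * amplitude q p τ θ k *
      Complex.exp (2 * Real.pi * Complex.I * m * k / 2 ^ q) =
    (kappaOne q p τ : ℂ) * corr q p τ m θ := by
  have hN : ((2 ^ q : ℕ) : ℂ) ≠ 0 := by simp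
  have hsq : (((Real.sqrt (2 ^ q) : ℝ) : ℂ)⁻¹) * ((Real.sqrt (2 ^ q) : ℝ) : ℂ)⁻¹ =
      ((2 ^ q : ℕ) : ℂ)⁻¹ := by
    rw [← mul_inv, ← Complex.ofReal_mul, Real.mul_self_sqrt (by positivity)]
    push_cast
    rfl
  have hterm : ∀ k : ℕ, (starRingEnd ℂ) (amplitude q p τ θ k) * amplitude q p τ θ k *
      Complex.exp (2 * Real.pi * Complex.I * m * k / 2 ^ q) =
      ∑ u ∈ window q, ∑ v ∈ window q, ((weight p τ u * weight p τ v : ℝ) : ℂ) *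
        fourier (skipZero v - skipZero u) θ * (((2 ^ q : ℕ) : ℂ)⁻¹ *
          Complex.exp (2 * Real.pi * Complex.I * ((u + m - v : ℤ) : ℂ) * k / (2 ^ q : ℕ))) := by
    intro k
    rw [mul_comm ((starRingEnd ℂ) _), amplitude, map_sum, Finset.sum_mul_sum, Finset.sum_mul]
    refine Finset.sum_congr rfl fun u _ => ?_
    rw [Finset.sum_mul]
    refine Finset.sum_congr rfl fun v _ => ?_
    have hexp : Complex.exp (2 * Real.pi * Complex.I * ((u + m - v : ℤ) : ℂ) * k / (2 ^ q : ℕ)) =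
        Complex.exp (2 * Real.pi * Complex.I * ((u + 2 ^ (q - 1) : ℤ) : ℂ) * k / 2 ^ q) *
        (starRingEnd ℂ) (Complex.exp
          (2 * Real.pi * Complex.I * ((v + 2 ^ (q - 1) : ℤ) : ℂ) * k / 2 ^ q)) *
        Complex.exp (2 * Real.pi * Complex.I * m * k / 2 ^ q) := by
      rw [← Complex.exp_conj, ← Complex.exp_add, ← Complex.exp_add]
      congr 1
      simp [map_ofNat (starRingEnd ℂ) 2]
      ring
    rw [hexp, ← hsq, sub_eq_add_neg, fourier_add, fourier_neg]
    simp only [map_mul, map_inv₀, Complex.conj_ofReal, Complex.conj_conj, Complex.ofReal_mul]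
    ring
  simp_rw [hterm]
  rw [Finset.sum_comm, corr, ContinuousMap.smul_apply, smul_eq_mul,
    mul_inv_cancel_left₀ (by exact_mod_cast (kappaOne_pos p τ).ne'), ContinuousMap.sum_apply]
  refine Finset.sum_congr rfl fun u hu => ?_
  rw [Finset.sum_comm]
  have hinner : ∀ v, (∑ k ∈ Finset.range (2 ^ q), ((weight p τ u * weight p τ v : ℝ) : ℂ) *
      fourier (skipZero v - skipZero u) θ * (((2 ^ q : ℕ) : ℂ)⁻¹ *
        Complex.exp (2 * Real.pi * Complex.I * ((u + m - v : ℤ) : ℂ) * k / (2 ^ q : ℕ)))) =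
      if ((2 ^ q : ℕ) : ℤ) ∣ u + m - v then ((weight p τ u * weight p τ v : ℝ) : ℂ) *
        fourier (skipZero v - skipZero u) θ else 0 := by
    intro v
    rw [← Finset.mul_sum, ← Finset.mul_sum, sum_exp_two_pi (by positivity)]
    split_ifs
    · rw [inv_mul_cancel₀ hN, mul_one]
    · simp
  simp_rw [hinner]
  have hmem := wrap_mem hq (u + m)
  rw [Finset.sum_eq_single_of_mem _ hmem, if_pos, ContinuousMap.smul_apply, smul_eq_mul]
  · refine ⟨(u + m + 2 ^ (q - 1)) / 2 ^ q, ?_⟩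
    have := Int.emod_add_mul_ediv (u + m + 2 ^ (q - 1)) (2 ^ q)
    push_cast
    unfold wrap
    linarith
  · intro v hv hne
    refine if_neg fun hdvd => hne ?_
    rw [← wrap_of_mem hq hv]
    unfold wrap
    have h : (v + 2 ^ (q - 1)) % 2 ^ q = (u + m + 2 ^ (q - 1)) % 2 ^ q := by
      refine Int.emod_eq_emod_iff_emod_sub_eq_zero.2 (Int.emod_eq_zero_of_dvd ?_)
      have := dvd_neg.2 hdvd
      rwa [neg_sub, Nat.cast_pow, Nat.cast_ofNat, ← add_sub_add_right_eq_sub] at this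
    rw [h]

theorem fourier_gridPoint {d q : ℕ} (b : Fin (d * q) → Bool) (n : ℤ) (i : Fin d) :
    fourier n (gridPoint b i) =
      Complex.exp (2 * Real.pi * Complex.I * n * (ofBits (block b i)) / 2 ^ q) := by
  rw [gridPoint, fourier_coe_apply]
  congr 1
  have : (Real.pi : ℂ) ≠ 0 := by exact_mod_cast Real.pi_ne_zero
  push_cast
  field_simp

/-- The expectation of a Fourier function factorizes over the dimensions of the torus. -/
theorem expect_phi {d q : ℕ} (hq : 1 ≤ q) (p τ : ℝ) (x : Torus d) (m : Fin d → ℤ) :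
    expect (rhoTilde d q p τ x) (diagOp fun b => phi m (gridPoint b)) =
      ∏ i, corr q p τ (m i) (x i) := by
  have hκ : 0 < kappa d q p τ := by
    rw [kappa_eq]
    exact pow_pos (kappaOne_pos p τ) d
  have hsq : ((Real.sqrt (kappa d q p τ) : ℝ) : ℂ)⁻¹ * ((Real.sqrt (kappa d q p τ) : ℝ) : ℂ)⁻¹ =
      (((kappaOne q p τ : ℝ) : ℂ) ^ d)⁻¹ := by
    rw [← mul_inv, ← Complex.ofReal_mul, Real.mul_self_sqrt hκ.le, kappa_eq, Complex.ofReal_pow]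
  have hterm : ∀ b : Fin (d * q) → Bool,
      (starRingEnd ℂ) (ContinuousLinearMap.adjoint (qft d q) (W d q p τ (xi d q p τ x)) b) *
        ContinuousLinearMap.adjoint (qft d q) (W d q p τ (xi d q p τ x)) b *
          phi m (gridPoint b) =
      (((kappaOne q p τ : ℝ) : ℂ) ^ d)⁻¹ *
        ∏ i, ((starRingEnd ℂ) (amplitude q p τ (x i) (ofBits (block b i))) *
          amplitude q p τ (x i) (ofBits (block b i)) *
            Complex.exp (2 * Real.pi * Complex.I * m i * (ofBits (block b i)) / 2 ^ q)) := by
    intro b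
    rw [rotated_xi_apply hq, phi, ← hsq, Finset.prod_mul_distrib, Finset.prod_mul_distrib]
    simp only [map_mul, map_inv₀, Complex.conj_ofReal, map_prod, fourier_gridPoint]
    ring
  rw [expect_rhoTilde_diagOp]
  simp_rw [hterm]
  rw [← Finset.mul_sum, sum_prod_block (fun i c =>
    (starRingEnd ℂ) (amplitude q p τ (x i) (ofBits c)) * amplitude q p τ (x i) (ofBits c) *
      Complex.exp (2 * Real.pi * Complex.I * m i * (ofBits c) / 2 ^ q))]
  have hone : ∀ i, (∑ c : Fin q → Bool, (starRingEnd ℂ) (amplitude q p τ (x i) (ofBits c)) *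
      amplitude q p τ (x i) (ofBits c) *
        Complex.exp (2 * Real.pi * Complex.I * m i * (ofBits c) / 2 ^ q)) =
      (kappaOne q p τ : ℂ) * corr q p τ (m i) (x i) := fun i => by
    rw [sum_ofBits q (fun k => (starRingEnd ℂ) (amplitude q p τ (x i) k) *
      amplitude q p τ (x i) k * Complex.exp (2 * Real.pi * Complex.I * m i * k / 2 ^ q)),
      sum_normSq_amplitude hq]
  simp_rw [hone]
  rw [Finset.prod_mul_distrib, Fin.prod_const,
    inv_mul_cancel_left₀ (pow_ne_zero d (by exact_mod_cast (kappaOne_pos p τ).ne'))]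

/-! ### Continuous functions on the torus -/

/-- The product `x ↦ ∏ᵢ gᵢ(xᵢ)` of continuous functions of the single angles. -/
def prodFun {d : ℕ} (g : Fin d → C(AddCircle (2 * Real.pi), ℂ)) : C(Torus d, ℂ) :=
  ∏ i, (g i).comp ⟨fun x : Torus d => x i, continuous_apply i⟩

theorem prodFun_apply {d : ℕ} (g : Fin d → C(AddCircle (2 * Real.pi), ℂ)) (x : Torus d) :
    prodFun g x = ∏ i, g i (x i) := by
  simp [prodFun, ContinuousMap.prod_apply]

theorem prodFun_fourier_apply {d : ℕ} (m : Fin d → ℤ) (x : Torus d) :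
    prodFun (fun i => fourier (m i)) x = phi m x := prodFun_apply _ x

theorem tendsto_prodFun {d : ℕ} {ι : Type*} {l : Filter ι}
    {g : ι → Fin d → C(AddCircle (2 * Real.pi), ℂ)} {g' : Fin d → C(AddCircle (2 * Real.pi), ℂ)}
    (h : ∀ i, Tendsto (fun a => g a i) l (𝓝 (g' i))) :
    Tendsto (fun a => prodFun (g a)) l (𝓝 (prodFun g')) :=
  tendsto_finsetProd _ fun i _ => ((ContinuousMap.continuous_precomp _).tendsto _).comp (h i)

theorem norm_prodFun_fourier_le {d : ℕ} (m : Fin d → ℤ) :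
    ‖prodFun (fun i => fourier (T := 2 * Real.pi) (m i))‖ ≤ 1 := by
  refine (ContinuousMap.norm_le _ zero_le_one).2 fun x => ?_
  rw [prodFun_apply, norm_prod]
  exact Finset.prod_le_one (fun _ _ => norm_nonneg _) fun i _ =>
    ((fourier (m i)).norm_coe_le_norm _).trans (fourier_norm _).le

/-- The frequencies `m` with `maxᵢ |mᵢ| ≤ M`. -/
def box (d M : ℕ) : Finset (Fin d → ℤ) :=
  Fintype.piFinset fun _ : Fin d => Finset.Icc (-(M : ℤ)) (M : ℤ)

theorem tendsto_box (d : ℕ) : Tendsto (box d) atTop atTop := by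
  refine tendsto_atTop_finset_of_monotone (fun M N h m hm => ?_) fun m => ?_
  · simp only [box, Fintype.mem_piFinset, Finset.mem_Icc] at hm ⊢
    exact fun i => by have := hm i; omega
  · refine ⟨∑ i, (m i).natAbs, ?_⟩
    simp only [box, Fintype.mem_piFinset, Finset.mem_Icc]
    intro i
    have := Finset.single_le_sum (f := fun i => (m i).natAbs) (fun _ _ => Nat.zero_le _)
      (Finset.mem_univ i)
    omega

/-- For a function in the Wiener algebra, the partial sums over boxes of the Fourier series
converge uniformly. -/
theorem IsWiener.exists_tendsto_sum_box {d : ℕ} {f : Torus d → ℂ} (hf : IsWiener f) :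
    ∃ F : C(Torus d, ℂ), (∀ x, F x = f x) ∧
      Tendsto (fun M => ∑ m ∈ box d M, fhat f m • prodFun (fun i => fourier (m i))) atTop
        (𝓝 F) := by
  have hs : Summable fun m : Fin d → ℤ =>
      fhat f m • prodFun (fun i => fourier (T := 2 * Real.pi) (m i)) := by
    refine .of_norm (hf.summable_norm.of_nonneg_of_le (fun _ => norm_nonneg _) fun m => ?_)
    rw [norm_smul]
    exact mul_le_of_le_one_right (norm_nonneg _) (norm_prodFun_fourier_le m)
  refine ⟨_, fun x => ?_, hs.hasSum.comp (tendsto_box d)⟩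
  have h := ContinuousMap.hasSum_apply hs.hasSum x
  simp only [ContinuousMap.smul_apply, prodFun_fourier_apply, smul_eq_mul] at h
  exact h.unique (hf.hasSum x)

/-! ### Real observables -/

theorem conj_phi {d : ℕ} (m : Fin d → ℤ) (x : Torus d) :
    (starRingEnd ℂ) (phi m x) = phi (-m) x := by
  simp only [phi, map_prod, Pi.neg_apply, fourier_neg]

theorem conj_fhat {d : ℕ} {f : Torus d → ℂ} (hf : ∀ x, (f x).im = 0) (m : Fin d → ℤ) :
    (starRingEnd ℂ) (fhat f m) = fhat f (-m) := by
  rw [fhat, fhat, ← integral_conj]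
  refine integral_congr_ae (Eventually.of_forall fun x => ?_)
  simp only [map_mul, conj_phi, neg_neg, Complex.conj_eq_iff_im.2 (hf x)]

theorem bandlimit_re {d : ℕ} {f : Torus d → ℂ} (hf : ∀ x, (f x).im = 0) (M : ℕ) (x : Torus d) :
    ((bandlimit f M x).re : ℂ) = bandlimit f M x := by
  rw [← Complex.conj_eq_iff_re, bandlimit, map_sum]
  refine Finset.sum_nbij' (fun m => -m) (fun m => -m) ?_ ?_ (fun _ _ => neg_neg _)
    (fun _ _ => neg_neg _) (fun m _ => ?_)
  iterate 2
    intro m hm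
    simp only [Fintype.mem_piFinset, Finset.mem_Icc, Pi.neg_apply] at hm ⊢
    exact fun i => by have := hm i; omega
  rw [map_mul, conj_fhat hf, conj_phi]

theorem simE_eq_simD {d : ℕ} {f : Torus d → ℂ} (hf : ∀ x, (f x).im = 0) (p τ : ℝ)
    (α : Fin d → ℝ) (M q : ℕ) (t : ℝ) (x : Torus d) :
    simE p τ α f M q t x = simD p τ α f M q t x := by
  simp only [simE, simD, obsE, obsD, bandlimit_re hf]

/-! ### The simulation and its limits -/

/-- The simulation evaluates, at the point moved by the flow, a function on the torus in which
each Fourier function of `f` is replaced by its expectation. -/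
theorem simD_eq {d q : ℕ} (hq : 1 ≤ q) (p τ : ℝ) (α : Fin d → ℝ) (f : Torus d → ℂ) (M : ℕ)
    (t : ℝ) (x : Torus d) :
    simD p τ α f M q t x =
      (∑ m ∈ box d M, fhat f m • prodFun (fun i => corr q p τ (m i))) (flow α t x) := by
  rw [ContinuousMap.sum_apply, simD, obsD, expect_rhoTilde_diagOp]
  simp_rw [ContinuousMap.smul_apply, prodFun_apply, ← expect_phi hq, expect_rhoTilde_diagOp,
    bandlimit, Finset.mul_sum, smul_eq_mul, Finset.mul_sum]
  rw [Finset.sum_comm]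
  exact Finset.sum_congr rfl fun m _ => Finset.sum_congr rfl fun b _ => by ring

/-- Uniform convergence on the torus is preserved by composition with the flow, uniformly in
time. -/
theorem iteratedLimit_of_tendsto {X Y : Type*} [TopologicalSpace Y] [CompactSpace Y]
    {S : ℕ → ℕ → ℝ → X → ℂ} {φ : ℝ → X → Y} {A : ℕ → ℕ → C(Y, ℂ)} {L : ℕ → C(Y, ℂ)} {F : C(Y, ℂ)}
    (hS : ∀ M q, 1 ≤ q → ∀ t x, S M q t x = A M q (φ t x))
    (hA : ∀ M, Tendsto (A M) atTop (𝓝 (L M))) (hL : Tendsto L atTop (𝓝 F)) :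
    IteratedLimit S fun t x => F (φ t x) := by
  refine ⟨fun M t x => L M (φ t x), fun K _ _ => ⟨fun M => ?_, ?_⟩⟩
  · refine ((ContinuousMap.tendsto_iff_tendstoUniformly.1 (hA M)).comp
      fun z : ℝ × X => φ z.1 z.2).tendstoUniformlyOn.congr ?_
    filter_upwards [eventually_ge_atTop 1] with q hq z _
    exact (hS M q hq z.1 z.2).symm
  · exact ((ContinuousMap.tendsto_iff_tendstoUniformly.1 hL).comp
      fun z : ℝ × X => φ z.1 z.2).tendstoUniformlyOn

/-- If each `P M` holds for all small positive numbers, then positive numbers strictly decreasing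
to zero can be chosen to satisfy `P 0`, `P 1`, `P 2`, …. -/
theorem exists_strictAnti_tendsto_zero {P : ℕ → ℝ → Prop} (h : ∀ M, ∀ᶠ τ in 𝓝[>] 0, P M τ) :
    ∃ τ : ℕ → ℝ, (∀ M, 0 < τ M) ∧ StrictAnti τ ∧ Tendsto τ atTop (𝓝 0) ∧ ∀ M, P M (τ M) := by
  obtain ⟨u, hu, hpos, hlim⟩ := exists_seq_strictAnti_tendsto (0 : ℝ)
  have hlim' : Tendsto u atTop (𝓝[>] 0) :=
    tendsto_nhdsWithin_iff.2 ⟨hlim, Eventually.of_forall hpos⟩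
  obtain ⟨φ, hφ, hP⟩ := extraction_forall_of_eventually fun M => hlim'.eventually (h M)
  exact ⟨u ∘ φ, fun M => hpos _, hu.comp_strictMono hφ, hlim.comp hφ.tendsto_atTop, hP⟩

end QECD

end

theorem mainTheorem2 (d : ℕ) (hd : 1 ≤ d) (p : ℝ) (hp0 : 0 < p) (hp1 : p < 1)
    (f : QECD.Torus d → ℂ) (hf : QECD.IsWiener f) :
    ∃ τ : ℕ → ℝ, (∀ M, 0 < τ M) ∧ StrictAnti τ ∧ Tendsto τ atTop (𝓝 0) ∧
      ∀ α : Fin d → ℝ, (∀ i, 0 < α i) → LinearIndependent ℚ α →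
        QECD.IteratedLimit (fun M q => QECD.simD p (τ M) α f M q)
          (fun t => QECD.koopman α t f) ∧
        ((∀ x, (f x).im = 0) →
          QECD.IteratedLimit (fun M q => QECD.simE p (τ M) α f M q)
            (fun t => QECD.koopman α t f)) := by
  open QECD in
  obtain ⟨F, hF, hFlim⟩ := hf.exists_tendsto_sum_box
  -- `τ_M` is chosen after `f`, so that only the error of the whole bandlimited observable matters
  have hsmall : ∀ M : ℕ, ∀ᶠ τ in 𝓝[>] (0 : ℝ),
      dist (∑ m ∈ box d M, fhat f m • prodFun (fun i => fourier (m i)))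
        (∑ m ∈ box d M, fhat f m • prodFun (fun i => corrInf p τ (m i))) < 1 / ((M : ℝ) + 1) := by
    intro M
    have h : Tendsto
        (fun τ => ∑ m ∈ box d M, fhat f m • prodFun (fun i => corrInf p τ (m i))) (𝓝[>] 0)
        (𝓝 (∑ m ∈ box d M, fhat f m • prodFun (fun i => fourier (m i)))) :=
      tendsto_finsetSum _ fun m _ =>
        (tendsto_prodFun fun i => tendsto_corrInf hp0 hp1.le (m i)).const_smul _
    refine (Metric.tendsto_nhds.1 h (1 / ((M : ℝ) + 1)) (by positivity)).mono fun τ hτ => ?_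
    rwa [dist_comm]
  obtain ⟨τ, hpos, hanti, hlim, hτ⟩ := exists_strictAnti_tendsto_zero hsmall
  refine ⟨τ, hpos, hanti, hlim, fun α _ _ => ?_⟩
  have hD : IteratedLimit (fun M q => simD p (τ M) α f M q) (fun t => koopman α t f) := by
    have h := iteratedLimit_of_tendsto (φ := flow α) (F := F)
      (L := fun M => ∑ m ∈ box d M, fhat f m • prodFun (fun i => corrInf p (τ M) (m i)))
      (fun M q hq => simD_eq hq p (τ M) α f M)
      (fun M => tendsto_finsetSum _ fun m _ =>
        (tendsto_prodFun fun i => tendsto_corr hp0 (hpos M) (m i)).const_smul _)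
      (hFlim.congr_dist (squeeze_zero (fun _ => dist_nonneg) (fun M => (hτ M).le)
        tendsto_one_div_add_atTop_nhds_zero_nat))
    simp only [hF] at h
    exact h
  refine ⟨hD, fun hreal => ?_⟩
  have hE : (fun M q => simE p (τ M) α f M q) = fun M q => simD p (τ M) α f M q := by
    funext M q t x
    exact simE_eq_simD hreal p (τ M) α M q t x
  rwa [hE]
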